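/- **Network.** Let $V$ be a finite set of nodes with a source $\mathtt r\in V$, let $E\subset V\times V$ be a set of directed links such that $(V,E)$ is acyclic (a DAG), let $c_e\in\mathbb N$ be the number of packets that link $e\in E$ can carry in one slot when it is activated, and let $\mathcal M\subset\{0,1\}^{E}$ be the set of incidence vectors of the sets of links that may be activated together under the interference constraints, where every subset of a feasible set of links is feasible. The configuration in slot $t$ is a vector $\sigma(t)\in\{0,1\}^{E}$ (link $e$ is ON if $\sigma(e,t)=1$), and $(\sigma(t))_t$ is a stationary ergodic process with one-slot distribution $p(\sigma)$. Let $\mathcal M_\sigma$ be the set of $s\in\mathcal M$ with $s_e=0$ for every link $e$ that is OFF in $\sigma$. In slot $t$, $A(t)$ new packets arrive at $\mathtt r$, where the $A(t)$ are i.i.d. over slots with mean $\lambda$. **Policies and capacity.** A policy $\pi$ chooses in every slot $t$ an activation vector $s(t)\in\mathcal M_{\sigma(t)}$ and sends, over each activated link $e=(i,j)$, at most $c_e$ of the packets that node $i$ has; its choices may be random and may depend on all past and future information. Let $R_i^\pi(T)$ be the number of distinct packets received by node $i$ up to time $T$ (for $i=\mathtt r$: the packets that have arrived). The policy is a broadcast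 policy of rate $\lambda$ if $\min_{i\in V}\liminf_{T\to\infty}R_i^\pi(T)/T=\lambda$ with probability $1$, where $\lambda$ is the arrival rate. The broadcast capacity $\lambda^*\in[0,\infty]$ is the supremum of all arrival rates $\lambda\ge 0$ for which there is a broadcast policy of rate $\lambda$. Let $\lambda^*_{\mathrm{stat}}$ be the broadcast capacity of the static network, in which all links of $E$ are ON in every slot. **Lemma.** Suppose that each link is ON with the same marginal probability $p$, i.e. $\sum_{\sigma:\,\sigma(e)=1}p(\sigma)=p$ for all $e\in E$, the joint distribution of the link states being otherwise arbitrary. Then $$p\,\lambda^*_{\mathrm{stat}}\le\lambda^*\le\lambda^*_{\mathrm{stat}}.$$ This holds for every choice, for each rate $\lambda$, of the law of the arrivals in the two networks and of their joint law with the configurations. -/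

import Mathlib

open MeasureTheory ProbabilityTheory Filter
open scoped NNReal ENNReal

universe u

/-- A static wireless network on the node set `V`: a source node, a finite set of directed
point-to-point links `(i, j)`, the number `c e` of packets that the link `e` can carry in one slot
when it is activated, and the set `M` of incidence vectors (in `{0,1}^E`) of the sets of links that
may be activated together under the interference constraints. A subset of a non-interfering set
of links is non-interfering, so `M` is closed under switching links off. -/
structure WirelessNetwork (V : Type u) where
  source : V
  links : Finset (V × V)
  c : {e : V × V // e ∈ links} → ℕ
  M : Set ({e : V × V // e ∈ links} → Bool)
  M_lower : IsLowerSet M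

namespace WirelessNetwork

/-- The links of the network, as a type. -/
abbrev Link {V : Type u} (N : WirelessNetwork V) : Type u := {e : V × V // e ∈ N.links}

/-- Network configurations, as vectors in `{0,1}^E`: `σ e = true` iff the link `e` is ON. -/
abbrev Config {V : Type u} (N : WirelessNetwork V) : Type u := N.Link → Bool

/-- The directed graph of the network has no directed cycle (nor loop). -/
def IsDAG {V : Type u} (N : WirelessNetwork V) : Prop :=
  ∀ v : V, ¬ Relation.TransGen (fun i j => (i, j) ∈ N.links) v v

/-- `M_σ`: the feasible activation vectors that activate only links that are ON in `σ`. -/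
def feasible {V : Type u} (N : WirelessNetwork V) (σ : N.Config) : Set (N.Link → Bool) :=
  {s | s ∈ N.M ∧ ∀ e, s e = true → σ e = true}

/-- The time shift on configuration sequences. -/
def shift {V : Type u} (N : WirelessNetwork V) (x : ℕ → N.Config) : ℕ → N.Config :=
  fun t => x (t + 1)

/-- The one-slot distribution `p(σ)` of a stationary configuration law. -/
noncomputable def stationaryDist {V : Type u} (N : WirelessNetwork V)
    (P : Measure (ℕ → N.Config)) (σ : N.Config) : ℝ≥0∞ :=
  P {x | x 0 = σ}

/-- The law of the configuration sequence of the static network: all links are always ON. -/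
noncomputable def staticLaw {V : Type u} (N : WirelessNetwork V) : Measure (ℕ → N.Config) :=
  Measure.dirac (fun _ _ => true)

/-- The random input of the network for each arrival rate `lam`: the joint law of the sequence
`(σ(t), A(t))` of configurations and numbers of packets arriving at the source, such that the
configurations have the law `P` and the arrivals are i.i.d. over slots with mean `lam`. -/
structure Traffic {V : Type u} (N : WirelessNetwork V) (P : Measure (ℕ → N.Config)) where
  law : ℝ≥0 → Measure (ℕ → N.Config × ℕ)
  config_law : ∀ lam, (law lam).map (fun z t => (z t).1) = P
  arrivals_indep : ∀ lam, iIndepFun (fun (t : ℕ) (z : ℕ → N.Config × ℕ) => (z t).2) (law lam)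
  arrivals_ident : ∀ lam t, IdentDistrib (fun z : ℕ → N.Config × ℕ => (z t).2)
    (fun z : ℕ → N.Config × ℕ => (z 0).2) (law lam) (law lam)
  arrivals_mean : ∀ lam, ∫⁻ z, ((z 0).2 : ℝ≥0∞) ∂(law lam) = lam

open Classical in
/-- The packets are numbered `0, 1, 2, …` in their order of arrival at the source. Given the
numbers `a t` of arrivals and the sets `f t e` of packets sent over link `e` in slot `t`,
`held a f T j` is the set of distinct packets that node `j` has received during the slots
`0, …, T - 1` (for the source: from outside). -/
noncomputable def held {V : Type u} (N : WirelessNetwork V) (a : ℕ → ℕ)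
    (f : ℕ → N.Link → Finset ℕ) : ℕ → V → Finset ℕ
  | 0, _ => ∅
  | T + 1, j => N.held a f T j
      ∪ (if j = N.source then
          Finset.Ico (∑ t ∈ Finset.range T, a t) (∑ t ∈ Finset.range (T + 1), a t) else ∅)
      ∪ (Finset.univ.filter (fun e : N.Link => e.1.2 = j)).biUnion (f T)

/-- A scheduling policy for the configurations `σ` and the arrivals `A`, on a probability space
that may carry further randomness. In slot `t` it activates a vector in `M_{σ(t)}`, and over each
activated link `(i, j)` it sends at most `c_{ij}` of the packets that node `i` has. The choices are
random variables; they may depend on the past and on the future. -/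
structure Policy {V : Type u} (N : WirelessNetwork V) {Ω : Type u} [MeasurableSpace Ω]
    (σ : ℕ → Ω → N.Config) (A : ℕ → Ω → ℕ) where
  act : ℕ → Ω → N.Link → Bool
  send : ℕ → Ω → N.Link → Finset ℕ
  act_measurable : ∀ t, Measurable (act t)
  send_measurable : ∀ t e n, MeasurableSet {ω | n ∈ send t ω e}
  act_feasible : ∀ t ω, act t ω ∈ N.feasible (σ t ω)
  send_card : ∀ t ω e, (send t ω e).card ≤ if act t ω e = true then N.c e else 0
  send_held : ∀ t ω e,
    send t ω e ⊆ N.held (fun s => A s ω) (fun s => send s ω) t e.1.1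

/-- `R_i(T)`: the number of distinct packets received by node `i` up to time `T`. -/
noncomputable def Policy.received {V : Type u} {N : WirelessNetwork V} {Ω : Type u}
    [MeasurableSpace Ω] {σ : ℕ → Ω → N.Config} {A : ℕ → Ω → ℕ} (π : N.Policy σ A)
    (T : ℕ) (ω : Ω) (i : V) : ℕ :=
  (N.held (fun s => A s ω) (fun s => π.send s ω) T i).card

/-- `π` is a broadcast policy of rate `lam`: almost surely,
`min_i liminf_T R_i(T) / T = lam`. -/
def Policy.IsBroadcastOfRate {V : Type u} {N : WirelessNetwork V} {Ω : Type u}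
    [MeasurableSpace Ω] {σ : ℕ → Ω → N.Config} {A : ℕ → Ω → ℕ} (π : N.Policy σ A)
    (μ : Measure Ω) (lam : ℝ≥0) : Prop :=
  ∀ᵐ ω ∂μ, ⨅ i : V, liminf (fun T : ℕ => (π.received T ω i : ℝ≥0∞) / (T : ℝ≥0∞)) atTop
    = (lam : ℝ≥0∞)

/-- There is a broadcast policy of rate `lam` when `Q` is the joint law of the configurations
and the arrivals. -/
def Supports {V : Type u} (N : WirelessNetwork V) (Q : Measure (ℕ → N.Config × ℕ))
    (lam : ℝ≥0) : Prop :=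
  ∃ (Ω : Type u) (_ : MeasurableSpace Ω) (μ : Measure Ω) (σ : ℕ → Ω → N.Config) (A : ℕ → Ω → ℕ),
    IsProbabilityMeasure μ ∧ (∀ t, Measurable (σ t)) ∧ (∀ t, Measurable (A t)) ∧
    μ.map (fun ω t => (σ t ω, A t ω)) = Q ∧
    ∃ π : N.Policy σ A, π.IsBroadcastOfRate μ lam

/-- The broadcast capacity: the supremum (in `[0, ∞]`) of all arrival rates `lam` for which there
is a broadcast policy of rate `lam`. -/
noncomputable def broadcastCapacity {V : Type u} (N : WirelessNetwork V)
    {P : Measure (ℕ → N.Config)} (𝒯 : N.Traffic P) : ℝ≥0∞ :=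
  ⨆ lam ∈ {lam : ℝ≥0 | N.Supports (𝒯.law lam) lam}, (lam : ℝ≥0∞)

end WirelessNetwork

/-! Both capacities are governed by finite lists of vectors `s 0, …, s (K - 1)` in `M` and by the
average capacity that a list activates into each node other than the source.

Necessity (`Supports.exists_inflow`): a node cannot receive more packets than the capacity activated
into it. So the activations of a broadcast policy along one sample path, cut off at a large time,
form a list whose average inflow into each such node is almost `lam`. Since `M_σ ⊆ M`, the list no
longer refers to the configurations.

Sufficiency (`supports_of_inflow`): run through the list cyclically, with a separate counter for
each configuration, and drop the OFF links. By Birkhoff's theorem each configuration has its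
frequency. Inflow is a sum over links, so only the marginals matter, and the average inflows are
exactly multiplied by `p`. On a DAG these inflows suffice: if every node accepts packets in order,
and only those that all its in-neighbours have, it is a queue fed by the slowest in-neighbour, and
the rate passes from node to node by well-founded induction (`growsAtLeast_inOrderCount`).

A list obtained from the static network thus serves the random one after thinning by `p`. A list
obtained from the random network serves the static one, where the marginal is `1`. All limits hold
pathwise almost surely, so the joint law of arrivals and configurations plays no role. -/

/-! ### Birkhoff's pointwise ergodic theorem, by a maximal-inequality argument. -/

section Birkhoff

open Topology

variable {α : Type*}

/-- The minimum of the first `n + 1` nonempty Birkhoff sums of `f` along the orbit of a point. -/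
noncomputable def birkhoffMin (T : α → α) (f : α → ℝ) : ℕ → α → ℝ
  | 0, x => f x
  | n + 1, x => f x + min 0 (birkhoffMin T f n (T x))

theorem birkhoffMin_succ_le (T : α → α) (f : α → ℝ) (n : ℕ) (x : α) :
    birkhoffMin T f (n + 1) x ≤ birkhoffMin T f n x := by
  induction n generalizing x with
  | zero => simp [birkhoffMin]
  | succ n ih =>
    exact add_le_add_right (min_le_min_left 0 (ih (T x))) (f x)

theorem birkhoffMin_antitone (T : α → α) (f : α → ℝ) (x : α) :
    Antitone fun n => birkhoffMin T f n x :=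
  antitone_nat_of_succ_le fun n => birkhoffMin_succ_le T f n x

theorem birkhoffMin_le_birkhoffSum (T : α → α) (f : α → ℝ) (n : ℕ) (x : α) :
    birkhoffMin T f n x ≤ birkhoffSum T f (n + 1) x := by
  induction n generalizing x with
  | zero => simp [birkhoffMin]
  | succ n ih =>
    rw [birkhoffMin, birkhoffSum_succ']
    gcongr
    exact (min_le_right _ _).trans (ih (T x))

variable [MeasurableSpace α] {μ : Measure α} {T : α → α} {f : α → ℝ}

theorem measurable_birkhoffMin (hT : Measurable T) (hf : Measurable f) (n : ℕ) :
    Measurable (birkhoffMin T f n) := by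
  induction n with
  | zero => exact hf
  | succ n ih => exact hf.add (measurable_const.min (ih.comp hT))

theorem integrable_birkhoffMin (hT : MeasurePreserving T μ μ)
    (hi : Integrable f μ) (n : ℕ) : Integrable (birkhoffMin T f n) μ := by
  induction n with
  | zero => exact hi
  | succ n ih =>
    have h := hT.integrable_comp_of_integrable ih
    exact hi.add ((integrable_zero α ℝ μ).inf h)

/-- If an observable of an ergodic system has positive mean, almost all of its sequences of
Birkhoff sums are bounded below. -/
theorem Ergodic.ae_bddBelow_birkhoffSum [IsProbabilityMeasure μ] (hT : Ergodic T μ)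
    (hf : Measurable f) (hi : Integrable f μ) (hpos : 0 < ∫ x, f x ∂μ) :
    ∀ᵐ x ∂μ, ∃ b : ℝ, ∀ n, b ≤ birkhoffSum T f n x := by
  -- The bad set, where the minima tend to `-∞`. It is invariant, since moving along the orbit
  -- changes the minima by a finite amount, so it is null or of full measure.
  set A : Set α := {x | ∀ b : ℕ, ∃ n, birkhoffMin T f n x < -(b : ℝ)} with hA
  have hTm := hT.toMeasurePreserving.measurable
  have hAm : MeasurableSet A := by
    have : A = ⋂ b : ℕ, ⋃ n, {x | birkhoffMin T f n x < -(b : ℝ)} := by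
      ext x; simp [hA]
    rw [this]
    exact MeasurableSet.iInter fun b => MeasurableSet.iUnion fun n =>
      measurableSet_lt (measurable_birkhoffMin hTm hf n) measurable_const
  have hinv : T ⁻¹' A = A := by
    ext x
    simp only [hA, Set.mem_preimage, Set.mem_ofPred_eq]
    constructor
    · intro h b
      obtain ⟨b', hb'⟩ := exists_nat_gt (f x + b)
      obtain ⟨n, hn⟩ := h b'
      refine ⟨n + 1, ?_⟩
      rw [birkhoffMin]
      have := min_le_right 0 (birkhoffMin T f n (T x))
      linarith
    · intro h b
      obtain ⟨b', hb'⟩ := exists_nat_gt (b - f x)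
      obtain ⟨n, hn⟩ := h b'
      refine ⟨n, ?_⟩
      have h1 := (birkhoffMin_succ_le T f n x).trans_lt hn
      rw [birkhoffMin] at h1
      have h2 : (0 : ℝ) ≤ b := b.cast_nonneg
      rcases min_cases 0 (birkhoffMin T f n (T x)) with ⟨h5, h6⟩ | ⟨h5, h6⟩ <;> rw [h5] at h1 <;>
        linarith
  have hnot : μ A = 0 := by
    rcases hT.toPreErgodic.prob_eq_zero_or_one hAm hinv with h | h
    · exact h
    exfalso
    have hae : ∀ᵐ x ∂μ, T x ∈ A := by
      have : ∀ᵐ x ∂μ, x ∈ A := (prob_compl_eq_zero_iff hAm).2 h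
      filter_upwards [this] with x hx
      rw [← hinv] at hx
      exact hx
    have hMT := fun n => hT.toMeasurePreserving.integrable_comp_of_integrable
      (integrable_birkhoffMin hT.toMeasurePreserving hi n)
    -- By `min + max = sum`, the integrand is the `(n + 1)`-st minimum minus the `n`-th one composed
    -- with `T`. Invariance of `μ` removes `T`, and the minima decrease in `n`.
    have hint : ∀ n, ∫ x, (f x - max (birkhoffMin T f n (T x)) 0) ∂μ ≤ 0 := by
      intro n
      have h1 : (fun x => f x - max (birkhoffMin T f n (T x)) 0)
          = fun x => birkhoffMin T f (n + 1) x - (birkhoffMin T f n ∘ T) x := by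
        ext x
        simp only [birkhoffMin, Function.comp]
        have := min_add_max 0 (birkhoffMin T f n (T x))
        rw [max_comm] at this
        linarith
      rw [h1, integral_sub (integrable_birkhoffMin hT.toMeasurePreserving hi _) (hMT n)]
      have h2 : ∫ x, (birkhoffMin T f n ∘ T) x ∂μ = ∫ x, birkhoffMin T f n x ∂μ := by
        conv_rhs => rw [← hT.toMeasurePreserving.map_eq]
        rw [integral_map hTm.aemeasurable
          (measurable_birkhoffMin hTm hf n).aestronglyMeasurable]
        rfl
      rw [h2, sub_nonpos]
      exact integral_mono (integrable_birkhoffMin hT.toMeasurePreserving hi _)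
        (integrable_birkhoffMin hT.toMeasurePreserving hi _) (birkhoffMin_succ_le T f n)
    -- If the bad set had full measure, the positive parts would eventually vanish almost
    -- everywhere, and the limit would give `∫ f ≤ 0`. The domination holds because the minima are
    -- at most `f`.
    have hlim : Tendsto (fun n => ∫ x, (f x - max (birkhoffMin T f n (T x)) 0) ∂μ) atTop
        (𝓝 (∫ x, f x ∂μ)) := by
      refine tendsto_integral_of_dominated_convergence (fun x => |f x| + |f (T x)|)
        (fun n => ?_) ?_ ?_ ?_
      · exact (hf.sub (((measurable_birkhoffMin hTm hf n).comp hTm).max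
          measurable_const)).aestronglyMeasurable
      · exact hi.abs.add (hT.toMeasurePreserving.integrable_comp_of_integrable hi).abs
      · intro n
        refine Eventually.of_forall fun x => ?_
        have h1 : birkhoffMin T f n (T x) ≤ f (T x) := birkhoffMin_antitone T f (T x) n.zero_le
        have h2 : max (birkhoffMin T f n (T x)) 0 ≤ |f (T x)| :=
          max_le (h1.trans (le_abs_self _)) (abs_nonneg _)
        have h3 : |max (birkhoffMin T f n (T x)) 0| = max (birkhoffMin T f n (T x)) 0 :=
          abs_of_nonneg (le_max_right _ _)
        exact (abs_sub _ _).trans (by rw [h3]; gcongr)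
      · filter_upwards [hae] with x hx
        obtain ⟨n, hn⟩ := hx 0
        refine tendsto_const_nhds.congr' ?_
        filter_upwards [eventually_ge_atTop n] with m hm
        have h1 := birkhoffMin_antitone T f (T x) hm
        rw [max_eq_right, sub_zero]
        simp only [Nat.cast_zero, neg_zero] at hn
        exact h1.trans hn.le
    exact absurd (le_of_tendsto' hlim hint) (not_le.2 hpos)
  filter_upwards [measure_eq_zero_iff_ae_notMem.1 hnot] with x hx
  simp only [hA, Set.mem_ofPred_eq, not_forall, not_exists, not_lt] at hx
  obtain ⟨b, hb⟩ := hx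
  refine ⟨-b, fun n => ?_⟩
  cases n with
  | zero => simp
  | succ n => exact (hb n).trans (birkhoffMin_le_birkhoffSum T f n x)

/-- Subtracting `∫ f - 1 / (k + 1)` leaves a positive mean, so the Birkhoff sums are bounded below,
and dividing by `n` makes the bound negligible. Countably many `k` give one null set for all `r`. -/
theorem Ergodic.ae_eventually_lt_birkhoffAverage [IsProbabilityMeasure μ] (hT : Ergodic T μ)
    (hf : Measurable f) (hi : Integrable f μ) :
    ∀ᵐ x ∂μ, ∀ r < ∫ x, f x ∂μ, ∀ᶠ n in atTop, r < birkhoffAverage ℝ T f n x := by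
  have key : ∀ᵐ x ∂μ, ∀ k : ℕ, ∃ b : ℝ, ∀ n,
      b ≤ birkhoffSum T (fun y => f y - (∫ x, f x ∂μ - 1 / (k + 1 : ℝ))) n x := by
    refine ae_all_iff.2 fun k => hT.ae_bddBelow_birkhoffSum (by fun_prop)
      (hi.sub (integrable_const _)) ?_
    rw [integral_sub hi (integrable_const _)]
    simp
    positivity
  filter_upwards [key] with x hx r hr
  obtain ⟨k, hk⟩ := exists_nat_one_div_lt (sub_pos.2 hr)
  obtain ⟨b, hb⟩ := hx k
  have h2 : Tendsto (fun n : ℕ => b / n + (∫ x, f x ∂μ - 1 / (k + 1 : ℝ))) atTop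
      (𝓝 (0 + (∫ x, f x ∂μ - 1 / (k + 1 : ℝ)))) :=
    (tendsto_const_div_atTop_nhds_zero_nat b).add_const _
  filter_upwards [h2.eventually_const_lt (u := r) (by linarith), eventually_gt_atTop 0]
    with n hn hn0
  have hn' : (0 : ℝ) < n := by exact_mod_cast hn0
  refine hn.trans_le ?_
  have := hb n
  simp only [birkhoffSum, Finset.sum_sub_distrib, Finset.sum_const, Finset.card_range,
    nsmul_eq_mul] at this
  rw [birkhoffAverage, birkhoffSum, smul_eq_mul, ← div_eq_inv_mul, le_div_iff₀ hn', add_mul,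
    div_mul_cancel₀ _ hn'.ne']
  linarith

/-- **Birkhoff's pointwise ergodic theorem**, for ergodic systems. -/
theorem Ergodic.ae_tendsto_birkhoffAverage [IsProbabilityMeasure μ] (hT : Ergodic T μ)
    (hf : Measurable f) (hi : Integrable f μ) :
    ∀ᵐ x ∂μ, Tendsto (fun n => birkhoffAverage ℝ T f n x) atTop (𝓝 (∫ x, f x ∂μ)) := by
  filter_upwards [hT.ae_eventually_lt_birkhoffAverage hf hi,
    hT.ae_eventually_lt_birkhoffAverage hf.neg hi.neg] with x h1 h2
  refine tendsto_order.2 ⟨h1, fun r hr => ?_⟩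
  have := h2 (-r) (by simp only [Pi.neg_apply, integral_neg]; linarith)
  filter_upwards [this] with n hn
  rw [birkhoffAverage_neg] at hn
  simpa using hn

end Birkhoff

/-! ### Linear growth rates and the departure rate of a queue. -/

section Rates

open Topology

/-- The sequence `x` grows at least at the linear rate `r`. -/
def GrowsAtLeast (x : ℕ → ℕ) (r : ℝ) : Prop :=
  ∀ ε > 0, ∃ C : ℝ, ∀ T : ℕ, (r - ε) * T - C ≤ x T

theorem exists_abs_sub_le_of_tendsto_div {y : ℕ → ℝ} {g : ℝ}
    (h : Tendsto (fun T : ℕ => y T / T) atTop (𝓝 g)) {ε : ℝ} (hε : 0 < ε) :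
    ∃ C : ℝ, ∀ T : ℕ, |y T - g * T| ≤ ε * T + C := by
  obtain ⟨T₀, hT₀⟩ := (Metric.tendsto_atTop.1 h) ε hε
  refine ⟨∑ s ∈ Finset.range (T₀ + 1), |y s - g * s|, fun T => ?_⟩
  have hsum : 0 ≤ ∑ s ∈ Finset.range (T₀ + 1), |y s - g * s| :=
    Finset.sum_nonneg fun _ _ => abs_nonneg _
  rcases le_or_gt T T₀ with hT | hT
  · have h1 := Finset.single_le_sum (f := fun s : ℕ => |y s - g * s|) (s := Finset.range (T₀ + 1))
      (fun _ _ => abs_nonneg _) (Finset.mem_range.2 (Nat.lt_succ_of_le hT))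
    have h2 : (0 : ℝ) ≤ ε * T := by positivity
    exact h1.trans (le_add_of_nonneg_left h2)
  · have hTpos : (0 : ℝ) < T := by exact_mod_cast (Nat.zero_le T₀).trans_lt hT
    have h1 := (hT₀ T hT.le).le
    rw [Real.dist_eq, div_sub' hTpos.ne', abs_div, abs_of_pos hTpos, div_le_iff₀ hTpos,
      mul_comm (T : ℝ) g] at h1
    linarith

theorem GrowsAtLeast.of_tendsto {x : ℕ → ℕ} {r : ℝ}
    (h : Tendsto (fun T : ℕ => (x T : ℝ) / T) atTop (𝓝 r)) : GrowsAtLeast x r := by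
  intro ε hε
  obtain ⟨C, hC⟩ := exists_abs_sub_le_of_tendsto_div h hε
  refine ⟨C, fun T => ?_⟩
  have := (abs_le.1 (hC T)).1
  linarith

theorem GrowsAtLeast.of_nonpos (x : ℕ → ℕ) {r : ℝ} (hr : r ≤ 0) : GrowsAtLeast x r := by
  refine fun ε hε => ⟨0, fun T => ?_⟩
  have h1 : (0 : ℝ) ≤ x T := Nat.cast_nonneg _
  have h2 : (r - ε) * T ≤ 0 := mul_nonpos_of_nonpos_of_nonneg (by linarith) T.cast_nonneg
  linarith

theorem GrowsAtLeast.le_liminf {x : ℕ → ℕ} {r : ℝ≥0} (h : GrowsAtLeast x r) :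
    (r : ℝ≥0∞) ≤ liminf (fun T : ℕ => (x T : ℝ≥0∞) / (T : ℝ≥0∞)) atTop := by
  refine le_of_forall_lt fun b hb => ?_
  obtain ⟨q, hbq, hqr⟩ := ENNReal.lt_iff_exists_nnreal_btwn.1 hb
  refine hbq.trans_le ?_
  have hqr' : (q : ℝ) < r := by exact_mod_cast hqr
  refine le_liminf_of_le (by isBoundedDefault) ?_
  obtain ⟨C, hC⟩ := h ((r - q) / 2) (by linarith)
  have h1 : Tendsto (fun T : ℕ => ((r - q) / 2 : ℝ) * T) atTop atTop :=
    tendsto_natCast_atTop_atTop.const_mul_atTop (by linarith)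
  filter_upwards [h1.eventually_ge_atTop C, eventually_gt_atTop 0] with T hT hT0
  rw [ENNReal.le_div_iff_mul_le (Or.inl (by simpa using hT0.ne')) (Or.inl (by simp))]
  have h2 : (q : ℝ) * T ≤ x T := by
    have := hC T
    nlinarith
  exact_mod_cast h2

/-- A queue fed by `x` whose service has the long-run rate `g ≥ r` has a departure process of rate
at least `r` if `x` has. -/
theorem GrowsAtLeast.min_recursion {R m x : ℕ → ℕ} {r g : ℝ} (hr : 0 ≤ r) (hrg : r ≤ g)
    (hR : ∀ t, R (t + 1) = min (R t + m t) (x t))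
    (hm : Tendsto (fun T : ℕ => ((∑ t ∈ Finset.range T, m t : ℕ) : ℝ) / T) atTop (𝓝 g))
    (hx : GrowsAtLeast x r) : GrowsAtLeast R r := by
  set y : ℕ → ℕ := fun T => ∑ t ∈ Finset.range T, m t with hy
  -- Either the cap `x` was never active, or `u` is the last slot in which it was: then `R (u + 1) =
  -- x u`, and full service follows.
  have key : ∀ T, y T ≤ R T ∨ ∃ u < T, x u + y T ≤ R T + y (u + 1) := by
    intro T
    induction T with
    | zero => left; simp [hy]
    | succ T ih =>
      have hyT : y (T + 1) = y T + m T := Finset.sum_range_succ _ _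
      rw [hR T]
      rcases le_total (x T) (R T + m T) with h | h
      · right
        exact ⟨T, T.lt_succ_self, by rw [min_eq_right h]⟩
      · rw [min_eq_left h]
        rcases ih with ih | ⟨u, hu, ih⟩
        · left; omega
        · right; exact ⟨u, by omega, by omega⟩
  intro ε hε
  obtain ⟨C₁, hC₁⟩ := exists_abs_sub_le_of_tendsto_div hm (ε := ε / 3) (by positivity)
  obtain ⟨C₂, hC₂⟩ := hx (ε / 3) (by positivity)
  have hC₁0 : 0 ≤ C₁ := by simpa using (abs_nonneg _).trans (hC₁ 0)
  have hC₂0 : 0 ≤ |C₂| := abs_nonneg _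
  -- The estimates of `y T` and `y (u + 1)` cost `C₁` each, that of `x u` costs `C₂`, and `g` pays
  -- for `u + 1` in place of `u`.
  refine ⟨2 * C₁ + |C₂| + g, fun T => ?_⟩
  have hyT := (abs_le.1 (hC₁ T)).1
  have hrgT : r * T ≤ g * T := by gcongr
  have hεT : 0 ≤ ε * T := by positivity
  rcases key T with h | ⟨u, hu, h⟩
  · have h' : (y T : ℝ) ≤ R T := by exact_mod_cast h
    simp only [hy] at h'
    linarith
  · have h' : (x u : ℝ) + y T ≤ R T + y (u + 1) := by exact_mod_cast h
    have hyu := (abs_le.1 (hC₁ (u + 1))).2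
    have hxu := hC₂ u
    have huT : (u : ℝ) + 1 ≤ T := by exact_mod_cast hu
    -- This is where `r ≤ g` enters: service after slot `u` is at least as fast as the required
    -- growth.
    have h3 : (g - r) * u ≤ (g - r) * T := by
      have : 0 ≤ g - r := by linarith
      gcongr
    have h4 : ε * (u + 1) ≤ ε * T := by gcongr
    have := le_abs_self C₂
    simp only [hy] at h'
    push_cast at hyu h' hyT ⊢
    linarith

end Rates

/-! ### In-order broadcasting on a directed acyclic graph. -/

theorem exists_finset_nat_allocation {ι : Type*} (S : Finset ι) (n : ι → ℕ) :
    ∃ f : ι → Finset ℕ, (∀ e, (f e).card ≤ n e) ∧ S.biUnion f = Finset.range (∑ e ∈ S, n e) := by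
  classical
  induction S using Finset.induction_on with
  | empty => exact ⟨fun _ => ∅, by simp, by simp⟩
  | insert b S hb ih =>
    obtain ⟨f, hf, hS⟩ := ih
    refine ⟨Function.update f b (Finset.Ico (∑ e ∈ S, n e) (∑ e ∈ insert b S, n e)), fun e => ?_, ?_⟩
    · rcases eq_or_ne e b with rfl | h
      · simp [Finset.sum_insert hb]
      · simpa [Function.update_of_ne h] using hf e
    · rw [Finset.biUnion_insert, Function.update_self]
      have : S.biUnion (Function.update f b
          (Finset.Ico (∑ e ∈ S, n e) (∑ e ∈ insert b S, n e))) = S.biUnion f :=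
        Finset.biUnion_congr rfl fun e he =>
          Function.update_of_ne (ne_of_mem_of_not_mem he hb) _ _
      rw [this, hS]
      ext k
      simp [Finset.sum_insert hb]
      omega

/-- Disjoint blocks of at most `n e` numbers, `e ∈ S`, that fill an initial segment of `ℕ`. -/
noncomputable def allocation {ι : Type*} (S : Finset ι) (n : ι → ℕ) : ι → Finset ℕ :=
  (exists_finset_nat_allocation S n).choose

theorem card_allocation_le {ι : Type*} (S : Finset ι) (n : ι → ℕ) (e : ι) :
    (allocation S n e).card ≤ n e :=
  (exists_finset_nat_allocation S n).choose_spec.1 e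

theorem biUnion_allocation {ι : Type*} (S : Finset ι) (n : ι → ℕ) :
    S.biUnion (allocation S n) = Finset.range (∑ e ∈ S, n e) :=
  (exists_finset_nat_allocation S n).choose_spec.2

namespace WirelessNetwork

variable {V : Type u} (N : WirelessNetwork V)

open Classical in
/-- The links that enter the node `j`. -/
noncomputable def inLinks (j : V) : Finset N.Link :=
  Finset.univ.filter fun e : N.Link => e.1.2 = j

/-- The number of packets that `e` can carry in one slot under the activation vector `s`. -/
def load (s : N.Link → Bool) (e : N.Link) : ℕ := if s e = true then N.c e else 0

/-- The number of packets that can enter the node `j` in one slot under the activation vector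
`s`. -/
noncomputable def inflow (s : N.Link → Bool) (j : V) : ℕ := ∑ e ∈ N.inLinks j, N.load s e

/-- The number of packets that all in-neighbours of `j` have, if each node `i` has the first
`ρ i` packets. -/
noncomputable def available (ρ : V → ℕ) (j : V) : ℕ := sInf {n | ∃ i, (i, j) ∈ N.links ∧ n = ρ i}

open Classical in
/-- One slot of in-order broadcasting: if each node `i` has the first `ρ i` packets, `a` packets
arrive and `s` is activated, then `j` gets the next packets which all its in-neighbours have. -/
noncomputable def inOrderStep (ρ : V → ℕ) (a : ℕ) (s : N.Link → Bool) (j : V) : ℕ :=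
  if j = N.source then ρ j + a else min (ρ j + N.inflow s j) (N.available ρ j)

/-- The number of packets at each node under in-order broadcasting. -/
noncomputable def inOrderCount (a : ℕ → ℕ) (s : ℕ → N.Link → Bool) : ℕ → V → ℕ
  | 0 => 0
  | t + 1 => N.inOrderStep (inOrderCount a s t) (a t) (s t)

open Classical in
/-- The packets sent over `e` by in-order broadcasting in one slot. -/
noncomputable def inOrderSend (ρ : V → ℕ) (s : N.Link → Bool) (e : N.Link) : Finset ℕ :=
  if e.1.2 = N.source then ∅ else
    ((allocation (N.inLinks e.1.2) (N.load s) e).image (ρ e.1.2 + ·)).filter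
      (· < N.available ρ e.1.2)

theorem card_inOrderSend_le (ρ : V → ℕ) (s : N.Link → Bool) (e : N.Link) :
    (N.inOrderSend ρ s e).card ≤ N.load s e := by
  rw [inOrderSend]
  split_ifs
  · simp
  · exact (Finset.card_filter_le _ _).trans
      (Finset.card_image_le.trans (card_allocation_le _ _ e))

theorem available_le (ρ : V → ℕ) {i j : V} (h : (i, j) ∈ N.links) : N.available ρ j ≤ ρ i :=
  Nat.sInf_le ⟨i, h, rfl⟩

theorem exists_available_eq (ρ : V → ℕ) {j : V} (h : ∃ i, (i, j) ∈ N.links) :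
    ∃ i, (i, j) ∈ N.links ∧ N.available ρ j = ρ i := by
  obtain ⟨i, hi⟩ := h
  exact Nat.sInf_mem (s := {n | ∃ i, (i, j) ∈ N.links ∧ n = ρ i}) ⟨_, i, hi, rfl⟩

/-- The default `sInf ∅ = 0` is the right value here: a node without in-links never gets a packet.
-/
theorem available_eq_zero (ρ : V → ℕ) {j : V} (h : ¬ ∃ i, (i, j) ∈ N.links) :
    N.available ρ j = 0 := by
  rw [available, Nat.sInf_eq_zero]
  right
  ext n
  simp only [Set.mem_ofPred_eq, Set.mem_empty_iff_false, iff_false]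
  exact fun ⟨i, hi, _⟩ => h ⟨i, hi⟩

theorem available_mono {ρ ρ' : V → ℕ} (h : ρ ≤ ρ') (j : V) :
    N.available ρ j ≤ N.available ρ' j := by
  by_cases hj : ∃ i, (i, j) ∈ N.links
  · obtain ⟨i, hi, h'⟩ := N.exists_available_eq ρ' hj
    rw [h']
    exact (N.available_le ρ hi).trans (h i)
  · rw [N.available_eq_zero ρ hj, N.available_eq_zero ρ' hj]

theorem inOrderSend_subset (ρ : V → ℕ) (s : N.Link → Bool) (e : N.Link) :
    N.inOrderSend ρ s e ⊆ Finset.range (ρ e.1.1) := by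
  rw [inOrderSend]
  split_ifs
  · simp
  · intro n hn
    rw [Finset.mem_filter] at hn
    exact Finset.mem_range.2 (hn.2.trans_le (N.available_le ρ e.2))

theorem inOrderCount_source (a : ℕ → ℕ) (s : ℕ → N.Link → Bool) (t : ℕ) :
    N.inOrderCount a s t N.source = ∑ i ∈ Finset.range t, a i := by
  induction t with
  | zero => simp [inOrderCount]
  | succ t ih => simp [inOrderCount, inOrderStep, Finset.sum_range_succ, ih]

theorem inOrderCount_succ_of_ne (a : ℕ → ℕ) (s : ℕ → N.Link → Bool) (t : ℕ) {j : V}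
    (hj : j ≠ N.source) :
    N.inOrderCount a s (t + 1) j = min (N.inOrderCount a s t j + N.inflow (s t) j)
      (N.available (N.inOrderCount a s t) j) := by
  simp [inOrderCount, inOrderStep, hj]

/-- The two claims need each other: the cap by `available` cannot lower a count that respects it,
and growing counts keep the cap respected in the next slot. -/
theorem inOrderCount_le_available (a : ℕ → ℕ) (s : ℕ → N.Link → Bool) (t : ℕ) :
    (∀ j ≠ N.source, N.inOrderCount a s t j ≤ N.available (N.inOrderCount a s t) j) ∧
      N.inOrderCount a s t ≤ N.inOrderCount a s (t + 1) := by
  have hmono : ∀ t, (∀ j ≠ N.source,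
      N.inOrderCount a s t j ≤ N.available (N.inOrderCount a s t) j) →
      N.inOrderCount a s t ≤ N.inOrderCount a s (t + 1) := by
    intro t h j
    by_cases hj : j = N.source
    · simp [inOrderCount, inOrderStep, hj]
    · rw [N.inOrderCount_succ_of_ne a s t hj]
      exact le_min (Nat.le_add_right _ _) (h j hj)
  induction t with
  | zero => exact ⟨fun j _ => by simp [inOrderCount], hmono 0 fun j _ => by simp [inOrderCount]⟩
  | succ t ih =>
    have h : ∀ j ≠ N.source,
        N.inOrderCount a s (t + 1) j ≤ N.available (N.inOrderCount a s (t + 1)) j := by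
      intro j hj
      rw [N.inOrderCount_succ_of_ne a s t hj]
      exact (min_le_right _ _).trans (N.available_mono ih.2 j)
    exact ⟨h, hmono _ h⟩

/-- The blocks of `allocation` tile the first `inflow` numbers. Shifted by `ρ j` and truncated at
`available`, they are exactly the packets that `j` needs next. -/
theorem biUnion_inOrderSend (ρ : V → ℕ) (s : N.Link → Bool) {j : V} (hj : j ≠ N.source) :
    (N.inLinks j).biUnion (N.inOrderSend ρ s)
      = Finset.Ico (ρ j) (min (ρ j + N.inflow s j) (N.available ρ j)) := by
  classical
  have h1 : (N.inLinks j).biUnion (N.inOrderSend ρ s) = (N.inLinks j).biUnion fun e =>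
      ((allocation (N.inLinks j) (N.load s) e).image (ρ j + ·)).filter (· < N.available ρ j) := by
    refine Finset.biUnion_congr rfl fun e he => ?_
    have he : e.1.2 = j := by simpa [inLinks] using he
    rw [inOrderSend, if_neg (by rwa [he])]
    subst he
    congr
  have h2 : ∀ k, (∃ e ∈ N.inLinks j, k ∈ allocation (N.inLinks j) (N.load s) e) ↔
      k < N.inflow s j := by
    intro k
    rw [← Finset.mem_biUnion, biUnion_allocation, Finset.mem_range, inflow]
  rw [h1]
  ext n
  simp only [Finset.mem_biUnion, Finset.mem_filter, Finset.mem_image, Finset.mem_Ico, lt_min_iff]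
  constructor
  · rintro ⟨e, he, ⟨k, hk, rfl⟩, hn⟩
    have := (h2 k).1 ⟨e, he, hk⟩
    omega
  · rintro ⟨hn1, hn2, hn3⟩
    obtain ⟨e, he, hk⟩ := (h2 (n - ρ j)).2 (by omega)
    exact ⟨e, he, ⟨n - ρ j, hk, by omega⟩, hn3⟩

/-- Under in-order broadcasting each node holds an initial segment of the packets. -/
theorem held_inOrderSend (a : ℕ → ℕ) (s : ℕ → N.Link → Bool) (t : ℕ) (j : V) :
    N.held a (fun t => N.inOrderSend (N.inOrderCount a s t) (s t)) t j
      = Finset.range (N.inOrderCount a s t j) := by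
  classical
  induction t with
  | zero => simp [held, inOrderCount]
  | succ t ih =>
    rw [held, ih]
    have hle := N.inOrderCount_le_available a s t
    by_cases hj : j = N.source
    · subst hj
      have : (Finset.univ.filter fun e : N.Link => e.1.2 = N.source).biUnion
          (N.inOrderSend (N.inOrderCount a s t) (s t)) = ∅ := by
        refine Finset.eq_empty_of_forall_notMem fun n hn => ?_
        obtain ⟨e, he, hn⟩ := Finset.mem_biUnion.1 hn
        rw [inOrderSend, if_pos (by simpa using he)] at hn
        simp at hn
      rw [if_pos rfl]
      erw [this]
      rw [Finset.union_empty, inOrderCount_source, inOrderCount_source]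
      ext n
      simp [Finset.sum_range_succ]
      omega
    · rw [if_neg hj, Finset.union_empty]
      have h3 := N.biUnion_inOrderSend (N.inOrderCount a s t) (s t) hj
      rw [inLinks] at h3
      have h4 := hle.1 j hj
      rw [N.inOrderCount_succ_of_ne a s t hj]
      ext n
      have h5 := Finset.ext_iff.1 h3 n
      simp only [Finset.mem_union, Finset.mem_range] at h5 ⊢
      rw [h5, Finset.mem_Ico]
      omega

/-- On a directed acyclic graph, in-order broadcasting has rate at least `r` at each node if the
arrivals have rate at least `r` and the activated capacity into each node has a rate of at least
`r`. -/
theorem growsAtLeast_inOrderCount [Finite V] (hN : N.IsDAG) {a : ℕ → ℕ} {s : ℕ → N.Link → Bool}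
    {r : ℝ} (hr : 0 ≤ r) {g : V → ℝ}
    (ha : GrowsAtLeast (fun T => ∑ t ∈ Finset.range T, a t) r)
    (hg : ∀ j ≠ N.source, r ≤ g j)
    (hs : ∀ j ≠ N.source, Tendsto (fun T : ℕ =>
      ((∑ t ∈ Finset.range T, N.inflow (s t) j : ℕ) : ℝ) / T) atTop (nhds (g j))) (j : V) :
    GrowsAtLeast (fun T => N.inOrderCount a s T j) r := by
  classical
  let rel : V → V → Prop := Relation.TransGen fun i j => (i, j) ∈ N.links
  have : IsTrans V rel := ⟨fun _ _ _ => Relation.TransGen.trans⟩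
  have : Std.Irrefl rel := ⟨hN⟩
  -- Acyclicity of a finite graph allows induction from in-neighbours to a node.
  have hwf : WellFounded rel := Finite.wellFounded_of_trans_of_irrefl rel
  induction j using hwf.induction with
  | _ j ih =>
  by_cases hj : j = N.source
  · subst hj
    simpa only [inOrderCount_source] using ha
  by_cases hin : ∃ i, (i, j) ∈ N.links
  · refine GrowsAtLeast.min_recursion hr (hg j hj)
      (fun t => N.inOrderCount_succ_of_ne a s t hj) (hs j hj) ?_
    intro ε hε
    have := Fintype.ofFinite V
    have hC : ∀ i, ∃ C : ℝ, (i, j) ∈ N.links →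
        ∀ T : ℕ, (r - ε) * T - C ≤ N.inOrderCount a s T i := by
      intro i
      by_cases hi : (i, j) ∈ N.links
      · obtain ⟨C, hC⟩ := ih i (Relation.TransGen.single hi) ε hε
        exact ⟨C, fun _ => hC⟩
      · exact ⟨0, fun h => absurd h hi⟩
    choose C hC using hC
    -- The in-neighbour attaining the minimum varies with `T`, so the constant must serve all of
    -- them.
    refine ⟨∑ i, |C i|, fun T => ?_⟩
    obtain ⟨i, hi, h⟩ := N.exists_available_eq (N.inOrderCount a s T) hin
    simp only [h]
    have h1 := hC i hi T
    have h2 := Finset.single_le_sum (f := fun i => |C i|) (fun i _ => abs_nonneg _)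
      (Finset.mem_univ i)
    have h3 := le_abs_self (C i)
    linarith
  -- Without in-links the inflow vanishes, so `g j = 0` and `r ≤ 0`.
  · refine GrowsAtLeast.of_nonpos _ ?_
    have h0 : ∀ s, N.inflow s j = 0 := by
      intro s
      refine Finset.sum_eq_zero fun e he => ?_
      have he : e.1.2 = j := by simpa [inLinks] using he
      exact absurd ⟨e.1.1, by rw [← he]; exact e.2⟩ hin
    have h1 := hs j hj
    simp only [h0, Finset.sum_const_zero, Nat.cast_zero, zero_div] at h1
    exact (hg j hj).trans (tendsto_nhds_unique h1 tendsto_const_nhds).le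

end WirelessNetwork

/-! ### Averages along cyclic lists with one counter per state. -/

section Cycling

open Topology

/-- The deviation from the mean returns to its value after each full cycle, so it is periodic in `n`
and hence bounded. -/
theorem exists_abs_sum_mod_sub_le (h : ℕ → ℝ) {K : ℕ} (hK : 0 < K) :
    ∃ B : ℝ, ∀ n : ℕ,
      |∑ k ∈ Finset.range n, h (k % K) - n * ((∑ k ∈ Finset.range K, h k) / K)| ≤ B := by
  set D : ℕ → ℝ := fun n =>
    ∑ k ∈ Finset.range n, h (k % K) - n * ((∑ k ∈ Finset.range K, h k) / K) with hD
  have hper : Function.Periodic D K := by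
    intro n
    have hK' : (K : ℝ) ≠ 0 := by exact_mod_cast hK.ne'
    have h1 : ∑ k ∈ Finset.range K, h (k % K) = ∑ k ∈ Finset.range K, h k :=
      Finset.sum_congr rfl fun k hk => by rw [Nat.mod_eq_of_lt (Finset.mem_range.1 hk)]
    simp only [hD]
    rw [add_comm n K, Finset.sum_range_add, h1]
    simp only [Nat.add_mod_left]
    push_cast
    field_simp
    ring
  refine ⟨∑ i ∈ Finset.range K, |D i|, fun n => ?_⟩
  change |D n| ≤ _
  rw [← hper.map_mod_nat n]
  exact Finset.single_le_sum (f := fun i => |D i|) (fun _ _ => abs_nonneg _)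
    (Finset.mem_range.2 (Nat.mod_lt n hK))

theorem tendsto_sum_mod_div (h : ℕ → ℝ) {K : ℕ} (hK : 0 < K) {n : ℕ → ℕ} {q : ℝ}
    (hn : Tendsto (fun T : ℕ => (n T : ℝ) / T) atTop (𝓝 q)) :
    Tendsto (fun T : ℕ => (∑ k ∈ Finset.range (n T), h (k % K)) / (T : ℝ)) atTop
      (𝓝 (q * ((∑ k ∈ Finset.range K, h k) / K))) := by
  obtain ⟨B, hB⟩ := exists_abs_sum_mod_sub_le h hK
  have h1 : Tendsto (fun T : ℕ => (∑ k ∈ Finset.range (n T), h (k % K)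
      - n T * ((∑ k ∈ Finset.range K, h k) / K)) / (T : ℝ)) atTop (𝓝 0) := by
    refine squeeze_zero_norm (fun T => ?_) (tendsto_const_div_atTop_nhds_zero_nat B)
    rw [norm_div, Real.norm_eq_abs, Real.norm_natCast]
    gcongr
    exact hB (n T)
  have h2 := h1.add (hn.mul_const ((∑ k ∈ Finset.range K, h k) / K))
  rw [zero_add] at h2
  refine h2.congr fun T => ?_
  ring

/-- Regroups the slots by state: the visits to `c` before `T` are numbered consecutively by the
counter of `c`. -/
theorem sum_count_eq {γ : Type*} [Fintype γ] [DecidableEq γ] (x : ℕ → γ) (F : ℕ → γ → ℝ) (T : ℕ) :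
    ∑ t ∈ Finset.range T, F (Nat.count (fun u => x u = x t) t) (x t)
      = ∑ c, ∑ k ∈ Finset.range (Nat.count (fun u => x u = c) T), F k c := by
  induction T with
  | zero => simp
  | succ T ih =>
    have h : ∀ c, ∑ k ∈ Finset.range (Nat.count (fun u => x u = c) (T + 1)), F k c
        = ∑ k ∈ Finset.range (Nat.count (fun u => x u = c) T), F k c
          + if x T = c then F (Nat.count (fun u => x u = c) T) c else 0 := by
      intro c
      rw [Nat.count_succ]
      split_ifs
      · rw [Finset.sum_range_succ]
      · simp
    rw [Finset.sum_range_succ, ih, Finset.sum_congr rfl fun c _ => h c, Finset.sum_add_distrib,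
      Finset.sum_ite_eq]
    simp

end Cycling

/-! ### The cyclic schedule, its inflow rates, and the policy built on it. -/

namespace WirelessNetwork

open Topology

variable {V : Type u} (N : WirelessNetwork V)

/-- The activation vector in slot `t` that runs, separately for each configuration, cyclically
through the list `s 0, …, s (K - 1)` and leaves out the links that are OFF. -/
def cyclicAct (s : ℕ → N.Link → Bool) (K : ℕ) (σ : ℕ → N.Config) (t : ℕ) : N.Link → Bool :=
  fun e => s (Nat.count (fun u => σ u = σ t) t % K) e && σ t e

theorem cyclicAct_mem_feasible {s : ℕ → N.Link → Bool} (hs : ∀ k, s k ∈ N.M) (K : ℕ)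
    (σ : ℕ → N.Config) (t : ℕ) : N.cyclicAct s K σ t ∈ N.feasible (σ t) := by
  refine ⟨N.M_lower ?_ (hs (Nat.count (fun u => σ u = σ t) t % K)), fun e he => ?_⟩
  · intro e
    exact Bool.and_le_left _ _
  · simp only [cyclicAct, Bool.and_eq_true] at he
    exact he.2

theorem measurable_cyclicAct {Ω : Type*} [MeasurableSpace Ω] {σ : ℕ → Ω → N.Config}
    (hσ : ∀ t, Measurable (σ t)) (s : ℕ → N.Link → Bool) (K t : ℕ) :
    Measurable fun ω => N.cyclicAct s K (fun u => σ u ω) t := by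
  have h1 : Measurable fun ω => Nat.count (fun u => σ u ω = σ t ω) t := by
    simp only [Nat.count_eq_card_filter_range, Finset.card_filter]
    exact Finset.measurable_sum _ fun u _ =>
      Measurable.ite (measurableSet_eq_fun (hσ u) (hσ t)) measurable_const measurable_const
  have h2 : Measurable fun z : ℕ × N.Config => (fun e => s (z.1 % K) e && z.2 e : N.Link → Bool) :=
    measurable_of_countable _
  exact h2.comp (h1.prodMk (hσ t))

theorem tendsto_inflow_cyclicAct [DecidableEq V] (s : ℕ → N.Link → Bool) {K : ℕ} (hK : 0 < K)
    {σ : ℕ → N.Config} {q : N.Config → ℝ} {p : ℝ}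
    (hσ : ∀ c, Tendsto (fun T : ℕ => (Nat.count (fun u => σ u = c) T : ℝ) / T) atTop (𝓝 (q c)))
    (hq : ∀ e : N.Link, ∑ c ∈ Finset.univ.filter (fun c : N.Config => c e = true), q c = p)
    (j : V) :
    Tendsto (fun T : ℕ =>
        ((∑ t ∈ Finset.range T, N.inflow (N.cyclicAct s K σ t) j : ℕ) : ℝ) / T) atTop
      (𝓝 (p * ((∑ k ∈ Finset.range K, N.inflow (s k) j : ℕ) : ℝ) / K)) := by
  set F : ℕ → N.Config → ℝ := fun k c =>
    ∑ e ∈ N.inLinks j, if c e = true then (N.load (s k) e : ℝ) else 0 with hF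
  have h1 : ∀ t, (N.inflow (N.cyclicAct s K σ t) j : ℝ)
      = F (Nat.count (fun u => σ u = σ t) t % K) (σ t) := by
    intro t
    simp only [inflow, hF, load, cyclicAct, Bool.and_eq_true]
    push_cast
    refine Finset.sum_congr rfl fun e _ => ?_
    split_ifs <;> simp_all
  have h2 : ∀ T : ℕ, ((∑ t ∈ Finset.range T, N.inflow (N.cyclicAct s K σ t) j : ℕ) : ℝ) / T
      = ∑ c, (∑ k ∈ Finset.range (Nat.count (fun u => σ u = c) T), F (k % K) c) / (T : ℝ) := by
    intro T
    rw [← Finset.sum_div, ← sum_count_eq σ (fun k c => F (k % K) c) T]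
    push_cast
    simp only [h1]
  -- Every configuration sees the whole list equally often. Exchanging the sums, a link contributes
  -- its average load times the total weight of the configurations in which it is ON, which is `p`
  -- for every link.
  have h3 : p * ((∑ k ∈ Finset.range K, N.inflow (s k) j : ℕ) : ℝ) / K
      = ∑ c, q c * ((∑ k ∈ Finset.range K, F k c) / K) := by
    have h4 : ∑ c, q c * (∑ k ∈ Finset.range K, F k c)
        = p * ((∑ k ∈ Finset.range K, N.inflow (s k) j : ℕ) : ℝ) := by
      simp only [hF, inflow]
      push_cast
      simp only [Finset.mul_sum]
      rw [Finset.sum_comm]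
      refine Finset.sum_congr rfl fun k _ => ?_
      rw [Finset.sum_comm]
      refine Finset.sum_congr rfl fun e _ => ?_
      rw [← hq e, Finset.sum_filter, Finset.sum_mul]
      refine Finset.sum_congr rfl fun c _ => ?_
      split_ifs <;> simp
    rw [← h4, Finset.sum_div]
    exact Finset.sum_congr rfl fun c _ => mul_div_assoc _ _ _
  rw [h3]
  simp only [h2]
  exact tendsto_finsetSum _ fun c _ => tendsto_sum_mod_div (fun k => F k c) hK (hσ c)

theorem iterate_shift_apply (x : ℕ → N.Config) (k t : ℕ) : N.shift^[k] x t = x (t + k) := by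
  induction k generalizing x with
  | zero => rfl
  | succ k ih => rw [Function.iterate_succ_apply, ih]; simp [shift]; congr 1

/-- In an ergodic configuration process almost surely the frequency of each configuration is its
probability. -/
theorem ae_tendsto_count_div [DecidableEq V] {P : Measure (ℕ → N.Config)} [IsProbabilityMeasure P]
    (hP : Ergodic N.shift P) :
    ∀ᵐ x ∂P, ∀ c, Tendsto (fun T : ℕ => (Nat.count (fun u => x u = c) T : ℝ) / T) atTop
      (𝓝 (N.stationaryDist P c).toReal) := by
  refine ae_all_iff.2 fun c => ?_
  have hS : MeasurableSet {x : ℕ → N.Config | x 0 = c} :=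
    measurableSet_eq_fun (measurable_pi_apply 0) measurable_const
  have hm : Measurable ({x : ℕ → N.Config | x 0 = c}.indicator (1 : (ℕ → N.Config) → ℝ)) :=
    measurable_one.indicator hS
  have hi : Integrable ({x : ℕ → N.Config | x 0 = c}.indicator (1 : (ℕ → N.Config) → ℝ)) P :=
    (integrable_const (1 : ℝ)).indicator hS
  filter_upwards [hP.ae_tendsto_birkhoffAverage hm hi] with x hx
  rw [integral_indicator_one hS] at hx
  refine hx.congr fun T => ?_
  rw [birkhoffAverage, birkhoffSum, smul_eq_mul, ← div_eq_inv_mul,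
    Nat.count_eq_card_filter_range, Finset.card_filter]
  push_cast
  congr 1
  refine Finset.sum_congr rfl fun t _ => ?_
  simp [Set.indicator_apply, iterate_shift_apply]

theorem measurable_inOrderCount [Finite V] {Ω : Type*} [MeasurableSpace Ω] {a : ℕ → Ω → ℕ}
    {s : ℕ → Ω → N.Link → Bool} (ha : ∀ t, Measurable (a t)) (hs : ∀ t, Measurable (s t)) (t : ℕ) :
    Measurable fun ω => N.inOrderCount (fun u => a u ω) (fun u => s u ω) t := by
  induction t with
  | zero => exact measurable_const
  | succ t ih =>
    have h : Measurable fun z : (V → ℕ) × ℕ × (N.Link → Bool) => N.inOrderStep z.1 z.2.1 z.2.2 :=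
      measurable_of_countable _
    exact h.comp (ih.prodMk ((ha t).prodMk (hs t)))

/-- In-order broadcasting, as a policy. -/
noncomputable def inOrderPolicy [Finite V] {Ω : Type u} [MeasurableSpace Ω]
    {σ : ℕ → Ω → N.Config} {A : ℕ → Ω → ℕ} (hA : ∀ t, Measurable (A t))
    (s : ℕ → Ω → N.Link → Bool) (hs : ∀ t, Measurable (s t))
    (hf : ∀ t ω, s t ω ∈ N.feasible (σ t ω)) : N.Policy σ A where
  act := s
  send t ω := N.inOrderSend (N.inOrderCount (fun u => A u ω) (fun u => s u ω) t) (s t ω)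
  act_measurable := hs
  send_measurable t e n := by
    have h : MeasurableSet {z : (V → ℕ) × (N.Link → Bool) | n ∈ N.inOrderSend z.1 z.2 e} :=
      (Set.to_countable _).measurableSet
    exact ((N.measurable_inOrderCount hA hs t).prodMk (hs t)) h
  act_feasible := hf
  send_card t ω e := N.card_inOrderSend_le _ _ e
  send_held t ω e := by
    rw [N.held_inOrderSend]
    exact N.inOrderSend_subset _ _ e

variable {N}

theorem Traffic.isProbabilityMeasure_law {P : Measure (ℕ → N.Config)} [IsProbabilityMeasure P]
    (𝒯 : N.Traffic P) (lam : ℝ≥0) : IsProbabilityMeasure (𝒯.law lam) := by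
  have hm : Measurable fun (z : ℕ → N.Config × ℕ) t => (z t).1 := by fun_prop
  constructor
  rw [← Set.preimage_univ (f := fun (z : ℕ → N.Config × ℕ) t => (z t).1),
    ← Measure.map_apply hm MeasurableSet.univ, 𝒯.config_law, measure_univ]

theorem Traffic.ae_tendsto_arrivals {P : Measure (ℕ → N.Config)} (𝒯 : N.Traffic P) (lam : ℝ≥0) :
    ∀ᵐ z ∂(𝒯.law lam), Tendsto (fun T : ℕ =>
      ((∑ t ∈ Finset.range T, (z t).2 : ℕ) : ℝ) / T) atTop (𝓝 lam) := by
  have hm : ∀ t, Measurable fun z : ℕ → N.Config × ℕ => ((z t).2 : ℝ) := fun t => by fun_prop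
  have hl : ∫⁻ z, ENNReal.ofReal ((z 0).2 : ℝ) ∂(𝒯.law lam) = lam := by
    simpa using 𝒯.arrivals_mean lam
  have hi : Integrable (fun z : ℕ → N.Config × ℕ => ((z 0).2 : ℝ)) (𝒯.law lam) := by
    refine ⟨(hm 0).aestronglyMeasurable, ?_⟩
    rw [hasFiniteIntegral_iff_ofReal (Eventually.of_forall fun z => Nat.cast_nonneg _), hl]
    exact ENNReal.coe_lt_top
  have hE : ∫ z, ((z 0).2 : ℝ) ∂(𝒯.law lam) = lam := by
    rw [integral_eq_lintegral_of_nonneg_ae (Eventually.of_forall fun z => Nat.cast_nonneg _)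
      (hm 0).aestronglyMeasurable, hl]
    simp
  have hc : Measurable (Nat.cast : ℕ → ℝ) := measurable_of_countable _
  have := strong_law_ae_real (μ := 𝒯.law lam) (fun t z => ((z t).2 : ℝ)) hi
    (fun s t hst => ((𝒯.arrivals_indep lam).indepFun hst).comp hc hc)
    (fun t => (𝒯.arrivals_ident lam t).comp hc)
  rw [hE] at this
  simpa using this

/-! ### Sufficiency and necessity of the inflow condition. -/

/-- Sufficiency: an ergodic network with common link marginal `p` supports the rate `lam` if some
finite list of non-interfering activation vectors has, after thinning by `p`, an average inflow of
at least `lam` into each node. -/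
theorem supports_of_inflow [DecidableEq V] [Finite V] (hN : N.IsDAG) {P : Measure (ℕ → N.Config)}
    [IsProbabilityMeasure P] (hP : Ergodic N.shift P) {p : ℝ≥0}
    (hp : ∀ e : N.Link,
      ∑ σ ∈ Finset.univ.filter (fun σ : N.Config => σ e = true), N.stationaryDist P σ = p)
    (𝒯 : N.Traffic P) {s : ℕ → N.Link → Bool} (hs : ∀ k, s k ∈ N.M) {K : ℕ} (hK : 0 < K)
    {lam : ℝ≥0} (hlam : ∀ j ≠ N.source,
      (lam : ℝ) * K ≤ p * (∑ k ∈ Finset.range K, N.inflow (s k) j : ℕ)) :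
    N.Supports (𝒯.law lam) lam := by
  have hprob := 𝒯.isProbabilityMeasure_law lam
  have hσ : ∀ t, Measurable fun z : ℕ → N.Config × ℕ => (z t).1 := fun t => by fun_prop
  have hA : ∀ t, Measurable fun z : ℕ → N.Config × ℕ => (z t).2 := fun t => by fun_prop
  -- The canonical space of inputs suffices, as the policy uses no further randomness.
  refine ⟨ℕ → N.Config × ℕ, inferInstance, 𝒯.law lam, fun t z => (z t).1, fun t z => (z t).2,
    hprob, hσ, hA, Measure.map_id, N.inOrderPolicy hA
      (fun t z => N.cyclicAct s K (fun u => (z u).1) t) (N.measurable_cyclicAct hσ s K)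
      (fun t z => N.cyclicAct_mem_feasible hs K (fun u => (z u).1) t), ?_⟩
  have hq : ∀ e : N.Link, ∑ c ∈ Finset.univ.filter (fun c : N.Config => c e = true),
      (N.stationaryDist P c).toReal = p := by
    intro e
    rw [← ENNReal.toReal_sum (f := N.stationaryDist P) fun c _ => measure_ne_top P _, hp e]
    rfl
  have hfreq : ∀ᵐ z ∂(𝒯.law lam), ∀ c, Tendsto (fun T : ℕ =>
      (Nat.count (fun u => (z u).1 = c) T : ℝ) / T) atTop (𝓝 (N.stationaryDist P c).toReal) := by
    have h := N.ae_tendsto_count_div hP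
    rw [← 𝒯.config_law lam] at h
    have h' := ae_of_ae_map (Measurable.aemeasurable (by fun_prop)) h
    rwa [𝒯.config_law lam] at h'
  filter_upwards [hfreq, 𝒯.ae_tendsto_arrivals lam] with z hz hz'
  have hK' : (0 : ℝ) < K := by exact_mod_cast hK
  have hgrow := N.growsAtLeast_inOrderCount hN (a := fun t => (z t).2)
    (s := N.cyclicAct s K fun u => (z u).1) lam.coe_nonneg (GrowsAtLeast.of_tendsto hz')
    (fun j hj => (le_div_iff₀ hK').2 (hlam j hj))
    (fun j _ => N.tendsto_inflow_cyclicAct s hK hz hq j)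
  have hrec : ∀ T j, (N.inOrderPolicy hA
      (fun t z => N.cyclicAct s K (fun u => (z u).1) t) (N.measurable_cyclicAct hσ s K)
      (fun t z => N.cyclicAct_mem_feasible hs K (fun u => (z u).1) t)).received T z j
      = N.inOrderCount (fun t => (z t).2) (N.cyclicAct s K fun u => (z u).1) T j := by
    intro T j
    refine (congrArg Finset.card (N.held_inOrderSend _ _ T j)).trans (Finset.card_range _)
  simp only [hrec]
  -- The minimum must equal `lam`: the source, whose rate is exactly `lam` by the law of large
  -- numbers, bounds it above.
  refine le_antisymm ((iInf_le _ N.source).trans_eq ?_) (le_iInf fun j => (hgrow j).le_liminf)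
  refine Tendsto.liminf_eq ?_
  simp only [inOrderCount_source]
  have h1 := (ENNReal.continuous_ofReal.tendsto _).comp hz'
  rw [ENNReal.ofReal_coe_nnreal] at h1
  refine h1.congr' ?_
  filter_upwards [eventually_gt_atTop 0] with T hT
  rw [Function.comp, ENNReal.ofReal_div_of_pos (by exact_mod_cast hT), ENNReal.ofReal_natCast,
    ENNReal.ofReal_natCast]

/-- Necessity: if a network supports the rate `lam`, then for each smaller rate `q` some finite
list of non-interfering activation vectors has an average inflow of at least `q` into each
node. -/
theorem Supports.exists_inflow [Finite V] {Q : Measure (ℕ → N.Config × ℕ)} {lam q : ℝ≥0}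
    (h : N.Supports Q lam) (hq : q < lam) :
    ∃ (s : ℕ → N.Link → Bool) (K : ℕ), (∀ k, s k ∈ N.M) ∧ 0 < K ∧ ∀ j ≠ N.source,
      (q : ℝ) * K ≤ (∑ k ∈ Finset.range K, N.inflow (s k) j : ℕ) := by
  obtain ⟨Ω, _, μ, σ, A, hμ, -, -, -, π, hπ⟩ := h
  -- One good sample path is enough; finiteness of `V` then gives one time `T` that works for all
  -- nodes.
  obtain ⟨ω, hω⟩ := hπ.exists
  have hev : ∀ j, ∀ᶠ T : ℕ in atTop, (q : ℝ≥0∞) < (π.received T ω j : ℝ≥0∞) / (T : ℝ≥0∞) := by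
    intro j
    refine eventually_lt_of_lt_liminf ?_
    have h1 := iInf_le
      (fun i => liminf (fun T : ℕ => (π.received T ω i : ℝ≥0∞) / (T : ℝ≥0∞)) atTop) j
    rw [hω] at h1
    exact lt_of_lt_of_le (by exact_mod_cast hq) h1
  obtain ⟨T, hT, hT0⟩ := ((eventually_all.2 hev).and (eventually_gt_atTop 0)).exists
  refine ⟨fun t => π.act t ω, T, fun k => (π.act_feasible k ω).1, hT0, fun j hj => ?_⟩
  have hcard : ∀ T, π.received T ω j ≤ ∑ t ∈ Finset.range T, N.inflow (π.act t ω) j := by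
    intro T
    induction T with
    | zero => simp [Policy.received, held]
    | succ T ih =>
      rw [Finset.sum_range_succ, Policy.received, held, if_neg hj, Finset.union_empty]
      refine (Finset.card_union_le _ _).trans (add_le_add ih ?_)
      exact Finset.card_biUnion_le.trans (Finset.sum_le_sum fun e _ => π.send_card T ω e)
  have h1 := (hT j).le
  rw [ENNReal.le_div_iff_mul_le (Or.inl (by simpa using hT0.ne')) (Or.inl (by simp))] at h1
  have h2 : (q : ℝ) * T ≤ π.received T ω j := by exact_mod_cast h1
  exact h2.trans (by exact_mod_cast hcard T)

variable (N)

/-- The law is a point mass at a fixed point of the shift, for which every measurable set is null or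
conull. -/
theorem ergodic_shift_staticLaw : Ergodic N.shift N.staticLaw := by
  have hm : Measurable N.shift := measurable_pi_lambda _ fun t => measurable_pi_apply (t + 1)
  refine ⟨⟨hm, Measure.map_dirac' hm _⟩, ⟨fun s hs _ => ?_⟩⟩
  rw [eventuallyConst_set]
  exact (em _).imp (ae_dirac_iff hs).2 (ae_dirac_iff hs.compl).2

theorem sum_stationaryDist_staticLaw [DecidableEq V] (e : N.Link) :
    ∑ σ ∈ Finset.univ.filter (fun σ : N.Config => σ e = true), N.stationaryDist N.staticLaw σ
      = (1 : ℝ≥0) := by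
  have hm : ∀ σ : N.Config, MeasurableSet {x : ℕ → N.Config | x 0 = σ} := fun σ =>
    measurableSet_eq_fun (measurable_pi_apply 0) measurable_const
  rw [Finset.sum_eq_single fun _ => true]
  · simp [stationaryDist, staticLaw, hm]
  · intro σ _ hσ
    simp [stationaryDist, staticLaw, hm, hσ.symm]
  · simp

end WirelessNetwork

/-! ### Comparison of the two capacities. -/

theorem lemma3 {V : Type u} [Fintype V] [DecidableEq V] (N : WirelessNetwork V) (hN : N.IsDAG)
    (P : Measure (ℕ → N.Config)) [IsProbabilityMeasure P] (hP : Ergodic N.shift P)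
    (p : ℝ≥0)
    (hp : ∀ e : N.Link,
      ∑ σ ∈ Finset.univ.filter (fun σ : N.Config => σ e = true), N.stationaryDist P σ = p)
    (𝒯 : N.Traffic P) (𝒯stat : N.Traffic N.staticLaw) :
    (p : ℝ≥0∞) * N.broadcastCapacity 𝒯stat ≤ N.broadcastCapacity 𝒯 ∧
      N.broadcastCapacity 𝒯 ≤ N.broadcastCapacity 𝒯stat := by
  constructor
  · simp only [WirelessNetwork.broadcastCapacity, ENNReal.mul_iSup]
    refine iSup₂_le fun lam hlam => le_of_forall_lt fun b hb => ?_
    rw [← ENNReal.coe_mul] at hb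
    obtain ⟨r, hbr, hr⟩ := ENNReal.lt_iff_exists_nnreal_btwn.1 hb
    refine hbr.trans_le (le_iSup₂_of_le r ?_ le_rfl)
    have hr' : r < p * lam := by exact_mod_cast hr
    have hp0 : p ≠ 0 := by rintro rfl; simp at hr'
    -- A static list of average inflow `r / p < lam` has average inflow `r` after thinning by `p`.
    obtain ⟨s, K, hs, hK, hsK⟩ := hlam.exists_inflow (q := r / p)
      ((div_lt_iff₀ (pos_iff_ne_zero.2 hp0)).2 (by rwa [mul_comm]))
    refine WirelessNetwork.supports_of_inflow hN hP hp 𝒯 hs hK fun j hj => ?_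
    have hp' : (0 : ℝ) < p := by positivity
    have := mul_le_mul_of_nonneg_left (hsK j hj) hp'.le
    rwa [NNReal.coe_div, ← mul_assoc, mul_div_cancel₀ _ hp'.ne'] at this
  · refine iSup₂_le fun lam hlam => le_of_forall_lt fun b hb => ?_
    obtain ⟨r, hbr, hr⟩ := ENNReal.lt_iff_exists_nnreal_btwn.1 hb
    refine hbr.trans_le (le_iSup₂_of_le r ?_ le_rfl)
    -- A list taken from the random network needs no thinning when all links are ON.
    obtain ⟨s, K, hs, hK, hsK⟩ := hlam.exists_inflow (q := r) (by exact_mod_cast hr)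
    have : IsProbabilityMeasure N.staticLaw := by
      unfold WirelessNetwork.staticLaw; infer_instance
    exact WirelessNetwork.supports_of_inflow hN N.ergodic_shift_staticLaw
      N.sum_stationaryDist_staticLaw 𝒯stat hs hK fun j hj => by simpa using hsK j hj
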